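/- **Lemma (Gagliardo–Nirenberg inequality).** Let $n\in\mathbb N$, let $p\in[1,n)$ be real, and put $p^*:=\frac{np}{n-p}$. There is a constant $c=c(n,p)>0$ such that the following holds. Let $\gamma,q>0$ and $\theta\in[0,1]$ satisfy $$\frac1\gamma\ \ge\ \frac{\theta}{p^*}+\frac{1-\theta}{q}.$$ Let $B_r\subset\mathbb R^n$ be an open ball of radius $r>0$ (with arbitrary centre), let $F$ be a finite-dimensional real inner product space (for instance $\mathbb R$ or $\mathbb R^N$), and let $f\in L^1_{\mathrm{loc}}(B_r;F)$ have a weak derivative $Df\in L^1_{\mathrm{loc}}(B_r;\mathcal L(\mathbb R^n,F))$. Then $$\bigg(\frac1{|B_r|}\int_{B_r}\Big|\frac fr\Big|^\gamma dx\bigg)^{\frac1\gamma}\le c\,\bigg(\frac1{|B_r|}\int_{B_r}\Big[|Df|^p+\Big|\frac fr\Big|^p\Big]dx\bigg)^{\frac\theta p}\bigg(\frac1{|B_r|}\int_{B_r}\Big|\frac fr\Big|^q dx\bigg)^{\frac{1-\theta}q}.$$ Here $|B_r|$ is the Lebesgue measure of $B_r$, and $|Df|$ is the operator norm of $Df$ (the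 Euclidean length of the gradient if $F=\mathbb R$). All integrals take values in $[0,\infty]$, with the conventions $\infty^0=0^0=1$ and $0\cdot\infty=0$. -/

import Mathlib

open MeasureTheory
open scoped ENNReal ContDiff

/-- `G` is the weak (distributional) derivative of `f` in the open set `Ω`: both are locally
integrable in `Ω`, and `∫_Ω (∂_v φ) f = - ∫_Ω φ (G v)` for every smooth real test function `φ` with
compact support in `Ω` and every direction `v`. -/
def HasWeakDerivOn {E F : Type*} [NormedAddCommGroup E] [NormedSpace ℝ E] [MeasureSpace E]
    [NormedAddCommGroup F] [NormedSpace ℝ F]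
    (f : E → F) (G : E → E →L[ℝ] F) (Ω : Set E) : Prop :=
  LocallyIntegrableOn f Ω volume ∧ LocallyIntegrableOn G Ω volume ∧
    ∀ φ : E → ℝ, ContDiff ℝ ∞ φ → HasCompactSupport φ → tsupport φ ⊆ Ω →
      ∀ v : E, ∫ x in Ω, (fderiv ℝ φ x v) • f x = -∫ x in Ω, φ x • G x v

/-- The Sobolev conjugate exponent `p* = np / (n - p)`, for `1 ≤ p < n`. -/
noncomputable def sobolevConj (n : ℕ) (p : ℝ) : ℝ := n * p / (n - p)

universe u

/-! The constant comes from the Sobolev inequality on a ball with both `Df` and `f / r` on the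
right; interpolation of exponents does the rest. For `C¹` functions on the unit ball, Gagliardo's
argument works without an extension operator. Near a point `a` of the closed ball, the segments from
`x` to `x + v` with `v` close to `-a` stay inside the ball. Integrating along them bounds `|w(x)|^s`
by a line integral over the ball, with the zero-order term paying for the far endpoint. Any open set
of directions contains a basis, so a Loomis–Whitney estimate in that basis, summed over a finite
cover, gives the `L¹` inequality for `|w|^s`. The choice `s = p(n-1)/(n-p)` and Hölder turn it into
the `L^p` inequality. Scaling gives every ball, and mollification on slightly smaller balls with
Fatou's lemma gives weakly differentiable `f`. For normalised measure, Jensen and Hölder bound the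
`γ`-mean by the `p*`- and `q`-means. -/

/-! ### Loomis–Whitney estimate in an arbitrary basis. -/

theorem exists_lintegral_rpow_le_of_le_lintegral_lines {n : ℕ} (hn : 2 ≤ n)
    (b : Module.Basis (Fin n) ℝ (EuclideanSpace ℝ (Fin n))) :
    ∃ C : ℝ≥0∞, C ≠ ⊤ ∧ ∀ G w : EuclideanSpace ℝ (Fin n) → ℝ≥0∞, Measurable G →
      (∀ x i, w x ≤ ∫⁻ t : ℝ, G (x + t • b i)) →
      ∫⁻ x, w x ^ ((n : ℝ) / (n - 1)) ≤ C * (∫⁻ x, G x) ^ ((n : ℝ) / (n - 1)) := by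
  have hn' : (2 : ℝ) ≤ n := by exact_mod_cast hn
  have hn1 : (0 : ℝ) < n - 1 := by linarith
  let L : (Fin n → ℝ) ≃L[ℝ] EuclideanSpace ℝ (Fin n) := b.equivFun.symm.toContinuousLinearEquiv
  have hL : ∀ a, L a = b.equivFun.symm a := fun _ ↦ rfl
  let m : (Fin n → ℝ) ≃ᵐ EuclideanSpace ℝ (Fin n) := L.toHomeomorph.toMeasurableEquiv
  let μ : Measure (EuclideanSpace ℝ (Fin n)) := (volume : Measure (Fin n → ℝ)).map L
  have : μ.IsAddHaarMeasure := L.isAddHaarMeasure_map volume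
  have hμ : ∀ g : EuclideanSpace ℝ (Fin n) → ℝ≥0∞, ∫⁻ x, g x ∂μ = ∫⁻ a, g (L a) := fun g ↦
    lintegral_map_equiv g m
  let c := Measure.addHaarScalarFactor (volume : Measure (EuclideanSpace ℝ (Fin n))) μ
  let d := Measure.addHaarScalarFactor μ (volume : Measure (EuclideanSpace ℝ (Fin n)))
  have hc : (volume : Measure (EuclideanSpace ℝ (Fin n))) = c • μ :=
    Measure.isAddLeftInvariant_eq_smul _ _
  have hd : μ = d • (volume : Measure (EuclideanSpace ℝ (Fin n))) :=
    Measure.isAddLeftInvariant_eq_smul _ _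
  have hexp : (0 : ℝ) ≤ n / (n - 1) := by positivity
  -- `c` and `d` compare Lebesgue measure with the Haar measure that is a product in the coordinates
  -- of `b`.
  refine ⟨c * (d : ℝ≥0∞) ^ ((n : ℝ) / (n - 1)),
    ENNReal.mul_ne_top ENNReal.coe_ne_top (by simp [hexp]), fun G w hG hw ↦ ?_⟩
  have hH : Real.HolderConjugate (Fintype.card (Fin n) : ℝ) ((n : ℝ) / (n - 1)) := by
    rw [Fintype.card_fin]
    exact (Real.holderConjugate_iff_eq_conjExponent (by linarith)).2 rfl
  have key : ∫⁻ a, w (L a) ^ ((n : ℝ) / (n - 1)) ≤ (∫⁻ a, G (L a)) ^ ((n : ℝ) / (n - 1)) := by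
    refine le_trans (lintegral_mono fun a ↦ ?_)
      (lintegral_prod_lintegral_pow_le (fun _ : Fin n ↦ (volume : Measure ℝ)) hH
        (hG.comp L.continuous.measurable))
    have hline : ∀ i, w (L a) ≤ ∫⁻ t : ℝ, G (L (Function.update a i t)) := by
      intro i
      refine (hw (L a) i).trans_eq ?_
      rw [← lintegral_sub_right_eq_self (fun t : ℝ ↦ G (L a + t • b i)) (a i)]
      refine lintegral_congr fun t ↦ congrArg G ?_
      have : Function.update a i t = a + Pi.single i (t - a i) := by
        ext j
        by_cases hj : j = i
        · subst hj; simp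
        · simp [hj]
      rw [this, map_add, hL (Pi.single i _), Module.Basis.equivFun_symm_apply]
      simp [Pi.single_apply]
    calc w (L a) ^ ((n : ℝ) / (n - 1))
        = ∏ _i : Fin n, w (L a) ^ ((1 : ℝ) / (n - 1)) := by
          rw [Finset.prod_const, Finset.card_univ, Fintype.card_fin, ← ENNReal.rpow_natCast,
            ← ENNReal.rpow_mul]
          congr 1
          field_simp
      _ ≤ ∏ i, (∫⁻ t : ℝ, G (L (Function.update a i t))) ^
            ((1 : ℝ) / ((Fintype.card (Fin n) : ℝ) - 1)) := by
          rw [Fintype.card_fin]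
          gcongr with i
          exact hline i
  calc ∫⁻ x, w x ^ ((n : ℝ) / (n - 1))
      = c * ∫⁻ a, w (L a) ^ ((n : ℝ) / (n - 1)) := by
        rw [← hμ (fun x ↦ w x ^ ((n : ℝ) / (n - 1)))]
        conv_lhs => rw [hc]
        rw [lintegral_smul_measure]
        rfl
    _ ≤ c * (∫⁻ x, G x ∂μ) ^ ((n : ℝ) / (n - 1)) := by rw [hμ]; gcongr
    _ = _ := by
        rw [hd, lintegral_smul_measure, ENNReal.smul_def, smul_eq_mul, ENNReal.mul_rpow_of_nonneg _ _ hexp,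
          mul_assoc]

/-! ### Pointwise bounds by integrals along segments. -/

theorem enorm_le_lintegral_Icc_add_deriv {F : Type*} [NormedAddCommGroup F] [NormedSpace ℝ F]
    {φ : ℝ → F} (hφ : ContDiff ℝ 1 φ) :
    ‖φ 0‖ₑ ≤ ∫⁻ t in Set.Icc (0 : ℝ) 1, (‖φ t‖ₑ + ‖deriv φ t‖ₑ) := by
  -- The cutoff `1 - t` removes the boundary term at `t = 1`; its derivative produces the zero-order
  -- term.
  have hψ : ContDiff ℝ 1 fun t : ℝ ↦ (1 - t) • φ t := by fun_prop
  have h := enorm_sub_le_lintegral_deriv_of_contDiffOn_Icc (hψ.contDiffOn (s := Set.Icc 0 1))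
    zero_le_one
  simp only [sub_self, zero_smul, sub_zero, one_smul, zero_sub, enorm_neg] at h
  refine h.trans (setLIntegral_mono' measurableSet_Icc fun t ht ↦ ?_)
  have hd : HasDerivAt (fun t : ℝ ↦ (1 - t) • φ t) ((1 - t) • deriv φ t + (-1 : ℝ) • φ t) t :=
    ((hasDerivAt_id t).const_sub 1).smul (hφ.differentiable one_ne_zero t).hasDerivAt
  rw [hd.deriv, add_comm ‖φ t‖ₑ]
  refine (enorm_add_le _ _).trans (add_le_add ?_ (by simp))
  rw [enorm_smul]
  refine mul_le_of_le_one_left' ?_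
  rw [Real.enorm_eq_ofReal_abs, ENNReal.ofReal_le_one, abs_le]
  constructor <;> linarith [ht.1, ht.2]

theorem enorm_le_lintegral_segment {E : Type*} [NormedAddCommGroup E] [NormedSpace ℝ E]
    {F : Type*} [NormedAddCommGroup F] [NormedSpace ℝ F] {w : E → F} (hw : ContDiff ℝ 1 w)
    (x v : E) :
    ‖w x‖ₑ ≤ ∫⁻ t in Set.Icc (0 : ℝ) 1,
      (‖w (x + t • v)‖ₑ + ‖fderiv ℝ w (x + t • v)‖ₑ * ‖v‖ₑ) := by
  have hline : ContDiff ℝ 1 fun t : ℝ ↦ x + t • v := by fun_prop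
  have hlined : ∀ t : ℝ, HasDerivAt (fun t : ℝ ↦ x + t • v) v t := fun t ↦ by
    simpa using ((hasDerivAt_id t).smul_const v).const_add x
  have h := enorm_le_lintegral_Icc_add_deriv (hw.comp hline)
  simp only [Function.comp_def, zero_smul, add_zero] at h
  refine h.trans (lintegral_mono fun t ↦ add_le_add le_rfl ?_)
  have := ((hw.differentiable one_ne_zero _).hasFDerivAt.comp_hasDerivAt t (hlined t)).deriv
  simp only [Function.comp_def] at this
  rw [this]
  exact ContinuousLinearMap.le_opENorm _ _

theorem enorm_rpow_le_lintegral_segment {E : Type*} [NormedAddCommGroup E] [NormedSpace ℝ E]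
    {F : Type*} [NormedAddCommGroup F] [InnerProductSpace ℝ F] {w : E → F} (hw : ContDiff ℝ 1 w)
    {s : ℝ} (hs : 1 ≤ s) (x : E) {v : E} (hv : ‖v‖ ≤ 2) :
    ‖w x‖ₑ ^ s ≤ ∫⁻ t in Set.Icc (0 : ℝ) 1, ENNReal.ofReal (2 * s) *
      (‖w (x + t • v)‖ₑ ^ (s - 1) * (‖w (x + t • v)‖ₑ + ‖fderiv ℝ w (x + t • v)‖ₑ)) := by
  have hv' : ‖v‖ₑ ≤ ENNReal.ofReal 2 := by
    rw [← ofReal_norm]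
    exact ENNReal.ofReal_le_ofReal hv
  have hK1 : (1 : ℝ≥0∞) ≤ ENNReal.ofReal (2 * s) := by
    rw [ENNReal.one_le_ofReal]; linarith
  have hbound : ∀ a d e : ℝ≥0∞, d ≤ ENNReal.ofReal s * (a ^ (s - 1) * e) →
      a ^ s + d * ‖v‖ₑ ≤ ENNReal.ofReal (2 * s) * (a ^ (s - 1) * (a + e)) := by
    intro a d e hd
    have h1 : a ^ s = a ^ (s - 1) * a := by
      conv_lhs => rw [show s = (s - 1) + 1 by ring]
      rw [ENNReal.rpow_add_of_nonneg _ _ (by linarith) zero_le_one, ENNReal.rpow_one]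
    rw [mul_add, mul_add]
    refine add_le_add ?_ ((mul_le_mul' hd hv').trans_eq ?_)
    · rw [h1]
      exact le_mul_of_one_le_left' hK1
    · rw [ENNReal.ofReal_mul zero_le_two]; ring
  rcases hs.eq_or_lt with rfl | hs1
  -- For `s = 1` the norm need not be differentiable at zeros of `w`, so the bound is applied to `w`
  -- itself.
  · refine (ENNReal.rpow_one _).trans_le ((enorm_le_lintegral_segment hw x v).trans ?_)
    refine lintegral_mono fun t ↦ ?_
    simpa using hbound ‖w (x + t • v)‖ₑ _ ‖fderiv ℝ w (x + t • v)‖ₑ (by simp)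
  · have hg : ContDiff ℝ 1 fun z ↦ ‖w z‖ ^ s := hw.norm_rpow hs1
    have hpow : ∀ z, ‖‖w z‖ ^ s‖ₑ = ‖w z‖ₑ ^ s := fun z ↦ by
      rw [Real.enorm_rpow_of_nonneg (norm_nonneg _) (by linarith), enorm_norm]
    have h := enorm_le_lintegral_segment hg x v
    simp only [hpow] at h
    refine h.trans (lintegral_mono fun t ↦ hbound _ _ _ ?_)
    have h := enorm_fderiv_norm_rpow_le (hw.differentiable one_ne_zero) (x := x + t • v)
      (p := ⟨s, by linarith⟩) hs1
    rw [mul_assoc] at h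
    refine h.trans_eq (congrArg (· * _) ?_)
    rw [ENNReal.ofReal, Real.toNNReal_of_nonneg (by linarith : 0 ≤ s)]
    rfl

/-! ### The `L¹` inequality on the unit ball, by covering. -/

theorem exists_basis_mem_ball {n : ℕ} (a : EuclideanSpace ℝ (Fin n)) {ρ : ℝ} (hρ : 0 < ρ) :
    ∃ b : Module.Basis (Fin n) ℝ (EuclideanSpace ℝ (Fin n)), ∀ i, b i ∈ Metric.ball a ρ := by
  have hspan : Submodule.span ℝ (Metric.ball a ρ) = ⊤ := by
    refine Submodule.eq_top_of_nonempty_interior' _ ⟨a, ?_⟩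
    exact interior_mono Submodule.subset_span
      (by rw [Metric.isOpen_ball.interior_eq]; exact Metric.mem_ball_self hρ)
  obtain ⟨s, hs, hss, hli⟩ := exists_linearIndependent ℝ (Metric.ball a ρ)
  let b₀ : Module.Basis s ℝ (EuclideanSpace ℝ (Fin n)) :=
    Module.Basis.mk hli (by simp [hss, hspan])
  have : Finite s := Module.Finite.finite_basis b₀
  have := Fintype.ofFinite s
  have hcard : Fintype.card s = n := by
    rw [← Module.finrank_eq_card_basis b₀, finrank_euclideanSpace_fin]
  let e : s ≃ Fin n := Fintype.equivFinOfCardEq hcard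
  refine ⟨b₀.reindex e, fun i ↦ ?_⟩
  simp only [b₀, Module.Basis.reindex_apply, Module.Basis.mk_apply]
  exact hs (e.symm i).2

/-- Since `v` nearly cancels `x₀`, the endpoint `x + v` lies in the unit ball; convexity gives the
rest of the segment. -/
theorem add_smul_mem_unitBall {E : Type*} [NormedAddCommGroup E] [NormedSpace ℝ E] {x x₀ v : E}
    (hx : x ∈ Metric.ball (0 : E) 1) (hx₀ : x ∈ Metric.ball x₀ (1 / 2))
    (hv : v ∈ Metric.ball (-x₀) (1 / 2)) {t : ℝ} (ht : t ∈ Set.Icc (0 : ℝ) 1) :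
    x + t • v ∈ Metric.ball (0 : E) 1 := by
  have hxv : x + v ∈ Metric.ball (0 : E) 1 := by
    rw [mem_ball_zero_iff]
    rw [mem_ball_iff_norm] at hx₀ hv
    calc ‖x + v‖ = ‖(x - x₀) + (v - -x₀)‖ := by congr 1; abel
      _ ≤ _ := norm_add_le _ _
      _ < 1 := by linarith
  have := (convex_ball (0 : E) 1) hx hxv (sub_nonneg.2 ht.2) ht.1 (by ring)
  convert this using 1
  module

theorem exists_lintegral_unitBall_rpow_le {n : ℕ} (hn : 2 ≤ n) {s : ℝ} (hs : 1 ≤ s) :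
    ∃ C : ℝ≥0∞, C ≠ ⊤ ∧ ∀ (F : Type u) [NormedAddCommGroup F] [InnerProductSpace ℝ F]
      (w : EuclideanSpace ℝ (Fin n) → F), ContDiff ℝ 1 w →
      ∫⁻ x in Metric.ball 0 1, (‖w x‖ₑ ^ s) ^ ((n : ℝ) / (n - 1)) ≤
        C * (∫⁻ x in Metric.ball 0 1, ‖w x‖ₑ ^ (s - 1) * (‖w x‖ₑ + ‖fderiv ℝ w x‖ₑ)) ^
          ((n : ℝ) / (n - 1)) := by
  have hn' : (2 : ℝ) ≤ n := by exact_mod_cast hn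
  have hn1 : (0 : ℝ) < n - 1 := by linarith
  have hexp : (0 : ℝ) < n / (n - 1) := by positivity
  choose b hb using fun a : EuclideanSpace ℝ (Fin n) ↦
    exists_basis_mem_ball (-a) (by norm_num : (0 : ℝ) < 1 / 2)
  choose C hC hCb using fun a ↦ exists_lintegral_rpow_le_of_le_lintegral_lines hn (b a)
  obtain ⟨T, hTb, hT⟩ := (isCompact_closedBall (0 : EuclideanSpace ℝ (Fin n)) 1).elim_nhds_subcover
    (fun a ↦ Metric.ball a (1 / 2)) fun a _ ↦ Metric.ball_mem_nhds a (by norm_num)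
  refine ⟨∑ a ∈ T, C a * ENNReal.ofReal (2 * s) ^ ((n : ℝ) / (n - 1)), ?_, fun F _ _ w hw ↦ ?_⟩
  · exact (ENNReal.sum_lt_top.2 fun a _ ↦ ENNReal.mul_lt_top (hC a).lt_top
      (ENNReal.rpow_lt_top_of_nonneg hexp.le ENNReal.ofReal_ne_top)).ne
  let g : EuclideanSpace ℝ (Fin n) → ℝ≥0∞ :=
    fun x ↦ ‖w x‖ₑ ^ (s - 1) * (‖w x‖ₑ + ‖fderiv ℝ w x‖ₑ)
  have hg : Measurable g := by
    have h1 : Measurable fun x ↦ ‖w x‖ₑ := hw.continuous.enorm.measurable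
    have h2 : Measurable fun x ↦ ‖fderiv ℝ w x‖ₑ :=
      (hw.continuous_fderiv one_ne_zero).enorm.measurable
    exact (h1.pow_const _).mul (h1.add h2)
  have hloc : ∀ a ∈ T, ∫⁻ x in Metric.ball 0 1 ∩ Metric.ball a (1 / 2),
      (‖w x‖ₑ ^ s) ^ ((n : ℝ) / (n - 1)) ≤ C a * ENNReal.ofReal (2 * s) ^ ((n : ℝ) / (n - 1)) *
        (∫⁻ x in Metric.ball 0 1, g x) ^ ((n : ℝ) / (n - 1)) := by
    intro a ha
    have hab : ‖a‖ ≤ 1 := by simpa using hTb a ha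
    have hms : MeasurableSet (Metric.ball (0 : EuclideanSpace ℝ (Fin n)) 1 ∩
      Metric.ball a (1 / 2)) := measurableSet_ball.inter measurableSet_ball
    -- Cutting off `w` to the small piece and `g` to the unit ball makes the line hypothesis hold on
    -- the whole space: segments starting in the piece do not leave the ball.
    have := hCb a ((Metric.ball 0 1).indicator fun x ↦ ENNReal.ofReal (2 * s) * g x)
      ((Metric.ball 0 1 ∩ Metric.ball a (1 / 2)).indicator fun x ↦ ‖w x‖ₑ ^ s)
      ((hg.const_mul _).indicator measurableSet_ball) ?_
    · rw [lintegral_indicator measurableSet_ball, lintegral_const_mul _ hg,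
        ENNReal.mul_rpow_of_nonneg _ _ hexp.le, ← mul_assoc] at this
      refine le_trans (le_of_eq ?_) this
      rw [← lintegral_indicator hms]
      refine lintegral_congr fun x ↦ ?_
      by_cases hx : x ∈ Metric.ball (0 : EuclideanSpace ℝ (Fin n)) 1 ∩ Metric.ball a (1 / 2)
      · simp only [Set.indicator_of_mem hx]
      · simp only [Set.indicator_of_notMem hx, ENNReal.zero_rpow_of_pos hexp]
    · intro x i
      by_cases hx : x ∈ Metric.ball (0 : EuclideanSpace ℝ (Fin n)) 1 ∩ Metric.ball a (1 / 2)
      · rw [Set.indicator_of_mem hx]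
        have hv : ‖b a i‖ ≤ 2 := by
          have := hb a i
          rw [mem_ball_iff_norm] at this
          calc ‖b a i‖ = ‖(b a i - -a) - a‖ := by congr 1; abel
            _ ≤ _ := norm_sub_le _ _
            _ ≤ 2 := by linarith
        refine (enorm_rpow_le_lintegral_segment hw hs x hv).trans ?_
        refine le_trans (le_of_eq ?_) (setLIntegral_le_lintegral (Set.Icc (0 : ℝ) 1) _)
        refine setLIntegral_congr_fun measurableSet_Icc fun t ht ↦ ?_
        simp only [g]
        rw [Set.indicator_of_mem (add_smul_mem_unitBall hx.1 hx.2 (hb a i) ht)]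
      · rw [Set.indicator_of_notMem hx]
        exact zero_le
  calc ∫⁻ x in Metric.ball 0 1, (‖w x‖ₑ ^ s) ^ ((n : ℝ) / (n - 1))
      ≤ ∫⁻ x in ⋃ a : T, Metric.ball 0 1 ∩ Metric.ball a.1 (1 / 2),
          (‖w x‖ₑ ^ s) ^ ((n : ℝ) / (n - 1)) := by
        refine lintegral_mono_set fun x hx ↦ ?_
        obtain ⟨a, ha, hxa⟩ := Set.mem_iUnion₂.1 (hT (Metric.ball_subset_closedBall hx))
        exact Set.mem_iUnion.2 ⟨⟨a, ha⟩, hx, hxa⟩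
    _ ≤ ∑ a ∈ T, ∫⁻ x in Metric.ball 0 1 ∩ Metric.ball a (1 / 2),
          (‖w x‖ₑ ^ s) ^ ((n : ℝ) / (n - 1)) := by
        refine (lintegral_iUnion_le _ _).trans_eq ?_
        rw [tsum_fintype, Finset.sum_coe_sort T fun a ↦
          ∫⁻ x in Metric.ball 0 1 ∩ Metric.ball a (1 / 2), (‖w x‖ₑ ^ s) ^ ((n : ℝ) / (n - 1))]
    _ ≤ _ := by
        rw [Finset.sum_mul]
        exact Finset.sum_le_sum hloc

/-! ### Sobolev inequality for `C¹` functions. -/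

theorem one_div_sobolevConj {n : ℕ} {p : ℝ} (hp : 1 ≤ p) (hpn : p < n) :
    1 / sobolevConj n p = 1 / p - 1 / n := by
  have : (0 : ℝ) < n := by linarith
  rw [sobolevConj]
  field_simp

theorem sobolevConj_pos {n : ℕ} {p : ℝ} (hp : 1 ≤ p) (hpn : p < n) : 0 < sobolevConj n p := by
  have : (0 : ℝ) < n := by linarith
  have := sub_pos.2 hpn
  rw [sobolevConj]
  positivity

theorem exists_sobolev_unitBall_of_contDiff {n : ℕ} {p : ℝ} (hp : 1 ≤ p) (hpn : p < n) :
    ∃ C : ℝ≥0∞, C ≠ ⊤ ∧ ∀ (F : Type u) [NormedAddCommGroup F] [InnerProductSpace ℝ F]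
      (w : EuclideanSpace ℝ (Fin n) → F), ContDiff ℝ 1 w →
      (∫⁻ x in Metric.ball 0 1, ‖w x‖ₑ ^ sobolevConj n p) ^ (1 / sobolevConj n p) ≤
        C * (∫⁻ x in Metric.ball 0 1, (‖fderiv ℝ w x‖ₑ ^ p + ‖w x‖ₑ ^ p)) ^ (1 / p) := by
  have hn : 2 ≤ n := by
    have : (1 : ℝ) < n := by linarith
    exact_mod_cast this
  have hn' : (2 : ℝ) ≤ n := by exact_mod_cast hn
  have hn1 : (0 : ℝ) < n - 1 := by linarith
  have hnp : (0 : ℝ) < n - p := by linarith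
  have hp0 : 0 < p := by linarith
  have hps := sobolevConj_pos hp hpn
  have hpi := one_div_sobolevConj hp hpn
  set P := sobolevConj n p with hP
  -- This `s` satisfies `s n/(n-1) = p*` and `(s-1) p/(p-1) = p*` (for `p > 1`), so the same
  -- integral `a` appears on both sides.
  have hs : 1 ≤ p * (n - 1) / (n - p) := by
    rw [le_div_iff₀ hnp]; nlinarith
  obtain ⟨C, hC, hCw⟩ := exists_lintegral_unitBall_rpow_le.{u} hn hs
  set s := p * (n - 1) / (n - p) with hsdef
  refine ⟨C ^ (((n : ℝ) - 1) / n) * ((2 : ℝ≥0∞) ^ (p - 1)) ^ (1 / p), ?_, fun F _ _ w hw ↦ ?_⟩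
  · exact ENNReal.mul_ne_top (ENNReal.rpow_ne_top_of_nonneg (by positivity) hC)
      (ENNReal.rpow_ne_top_of_nonneg (by positivity)
        (ENNReal.rpow_ne_top_of_nonneg (by linarith) (by simp)))
  have hm1 : Measurable fun x ↦ ‖w x‖ₑ := hw.continuous.enorm.measurable
  have hm2 : Measurable fun x ↦ ‖fderiv ℝ w x‖ₑ :=
    (hw.continuous_fderiv one_ne_zero).enorm.measurable
  set a := ∫⁻ x in Metric.ball 0 1, ‖w x‖ₑ ^ P with ha
  set D := ∫⁻ x in Metric.ball 0 1, (‖fderiv ℝ w x‖ₑ ^ p + ‖w x‖ₑ ^ p) with hD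
  -- Finiteness, from boundedness of `w` on the compact closed ball, permits division by a power of
  -- `a` at the end.
  have hatop : a ≠ ⊤ := by
    obtain ⟨M, hM⟩ := (isCompact_closedBall (0 : EuclideanSpace ℝ (Fin n)) 1).exists_bound_of_continuousOn
      hw.continuous.continuousOn
    refine ne_top_of_le_ne_top (b := ∫⁻ x in Metric.ball (0 : EuclideanSpace ℝ (Fin n)) 1,
      ENNReal.ofReal M ^ P) ?_ (setLIntegral_mono' measurableSet_ball fun x hx ↦ ?_)
    · rw [setLIntegral_const]
      exact ENNReal.mul_ne_top (ENNReal.rpow_ne_top_of_nonneg hps.le ENNReal.ofReal_ne_top)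
        measure_ball_lt_top.ne
    · gcongr
      rw [← ofReal_norm]
      exact ENNReal.ofReal_le_ofReal (hM x (Metric.ball_subset_closedBall hx))
  rcases eq_or_ne a 0 with ha0 | ha0
  · rw [ha0, ENNReal.zero_rpow_of_pos (by positivity)]
    exact zero_le
  have hholder : ∫⁻ x in Metric.ball 0 1, ‖w x‖ₑ ^ (s - 1) * (‖w x‖ₑ + ‖fderiv ℝ w x‖ₑ) ≤
      a ^ ((p - 1) / p) * (((2 : ℝ≥0∞) ^ (p - 1)) ^ (1 / p) * D ^ (1 / p)) := by
    have h := ENNReal.lintegral_mul_norm_pow_le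
      (μ := volume.restrict (Metric.ball (0 : EuclideanSpace ℝ (Fin n)) 1))
      (f := fun x ↦ ‖w x‖ₑ ^ P) (g := fun x ↦ (‖w x‖ₑ + ‖fderiv ℝ w x‖ₑ) ^ p)
      (hm1.pow_const _).aemeasurable ((hm1.add hm2).pow_const _).aemeasurable
      (p := (p - 1) / p) (q := 1 / p) (by have := sub_nonneg.2 hp; positivity) (by positivity)
      (by field_simp; ring)
    have he : P * ((p - 1) / p) = s - 1 := by
      rw [hP, hsdef, sobolevConj]; field_simp; ring
    simp only [← ENNReal.rpow_mul, he, mul_one_div_cancel hp0.ne', ENNReal.rpow_one] at h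
    refine h.trans ?_
    gcongr
    rw [← ENNReal.mul_rpow_of_nonneg _ _ (by positivity)]
    gcongr
    rw [hD, ← lintegral_const_mul' _ _ (ENNReal.rpow_ne_top_of_nonneg (by linarith) (by simp))]
    refine lintegral_mono fun x ↦ ?_
    rw [add_comm (‖fderiv ℝ w x‖ₑ ^ p)]
    exact ENNReal.rpow_add_le_mul_rpow_add_rpow _ _ hp
  have hmain : a ≤ C * (a ^ ((p - 1) / p) * (((2 : ℝ≥0∞) ^ (p - 1)) ^ (1 / p) * D ^ (1 / p))) ^
      ((n : ℝ) / (n - 1)) := by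
    refine le_trans (le_of_eq ?_) ((hCw F w hw).trans ?_)
    · rw [ha]
      simp only [← ENNReal.rpow_mul]
      have : s * (n / (n - 1)) = P := by rw [hP, hsdef, sobolevConj]; field_simp
      rw [this]
    · gcongr
  -- As `(n-1)/n = (p-1)/p + 1/p*`, cancelling `a ^ ((p-1)/p)` leaves the Sobolev norm on the left.
  have hroot := ENNReal.rpow_le_rpow hmain (z := ((n : ℝ) - 1) / n) (by positivity)
  rw [ENNReal.mul_rpow_of_nonneg _ _ (by positivity), ← ENNReal.rpow_mul,
    show (n : ℝ) / (n - 1) * ((n - 1) / n) = 1 by field_simp, ENNReal.rpow_one,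
    show ((n : ℝ) - 1) / n = (p - 1) / p + 1 / P by rw [hpi]; field_simp; ring,
    ENNReal.rpow_add_of_nonneg _ _ (by have := sub_nonneg.2 hp; positivity) (by positivity)] at hroot
  have e1 : a ^ ((p - 1) / p) ≠ 0 := by
    rw [Ne, ENNReal.rpow_eq_zero_iff]; simp [ha0, hatop]
  have e2 : a ^ ((p - 1) / p) ≠ ⊤ :=
    ENNReal.rpow_ne_top_of_nonneg (by have := sub_nonneg.2 hp; positivity) hatop
  rw [show ((n : ℝ) - 1) / n = (p - 1) / p + 1 / P by rw [hpi]; field_simp; ring]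
  refine (ENNReal.mul_le_mul_iff_right e1 e2).1 (hroot.trans_eq ?_)
  ring

theorem laverage_ball_comp_add_smul {n : ℕ} (y : EuclideanSpace ℝ (Fin n)) {ρ : ℝ} (hρ : 0 < ρ)
    (g : EuclideanSpace ℝ (Fin n) → ℝ≥0∞) :
    ⨍⁻ x in Metric.ball (0 : EuclideanSpace ℝ (Fin n)) 1, g (y + ρ • x) ∂volume =
      ⨍⁻ x in Metric.ball y ρ, g x ∂volume := by
  let m : EuclideanSpace ℝ (Fin n) ≃ᵐ EuclideanSpace ℝ (Fin n) :=
    (MeasurableEquiv.smul₀ ρ hρ.ne').trans (MeasurableEquiv.addLeft y)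
  have hm : ∀ x, m x = y + ρ • x := fun _ ↦ rfl
  let c : ℝ≥0∞ := ENNReal.ofReal |(ρ ^ Module.finrank ℝ (EuclideanSpace ℝ (Fin n)))⁻¹|
  have hc : c ≠ 0 := by
    simp only [c, ne_eq, ENNReal.ofReal_eq_zero, not_le]
    positivity
  have hmap : (volume : Measure (EuclideanSpace ℝ (Fin n))).map m = c • volume := by
    have : (m : EuclideanSpace ℝ (Fin n) → EuclideanSpace ℝ (Fin n)) =
      (fun x ↦ y + x) ∘ (fun x ↦ ρ • x) := rfl
    rw [this, ← Measure.map_map (measurable_const_add y) (measurable_const_smul ρ),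
      Measure.map_addHaar_smul _ hρ.ne', Measure.map_smul, map_add_left_eq_self]
  have hpre : m ⁻¹' Metric.ball y ρ = Metric.ball 0 1 := by
    ext x
    simp [hm, norm_smul, abs_of_pos hρ, mul_lt_iff_lt_one_right hρ]
  have hint : ∫⁻ x in Metric.ball (0 : EuclideanSpace ℝ (Fin n)) 1, g (y + ρ • x) =
      c * ∫⁻ x in Metric.ball y ρ, g x := by
    rw [← hpre, ← smul_eq_mul, ← lintegral_smul_measure, ← Measure.restrict_smul, ← hmap,
      m.restrict_map, lintegral_map_equiv]
    rfl
  have hvol : volume (Metric.ball (0 : EuclideanSpace ℝ (Fin n)) 1) =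
      c * volume (Metric.ball y ρ) := by
    rw [← hpre, ← m.map_apply, hmap]; rfl
  rw [setLAverage_eq, setLAverage_eq, hint, hvol,
    ENNReal.mul_div_mul_left _ _ hc ENNReal.ofReal_ne_top]

theorem exists_sobolev_ball_of_contDiff {n : ℕ} {p : ℝ} (hp : 1 ≤ p) (hpn : p < n) :
    ∃ C : ℝ≥0∞, C ≠ ⊤ ∧ ∀ (F : Type u) [NormedAddCommGroup F] [InnerProductSpace ℝ F]
      (w : EuclideanSpace ℝ (Fin n) → F), ContDiff ℝ 1 w →
      ∀ (y : EuclideanSpace ℝ (Fin n)) (ρ : ℝ), 0 < ρ →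
      (⨍⁻ x in Metric.ball y ρ, ‖ρ⁻¹ • w x‖ₑ ^ sobolevConj n p ∂volume) ^
          (1 / sobolevConj n p) ≤
        C * (⨍⁻ x in Metric.ball y ρ, (‖fderiv ℝ w x‖ₑ ^ p + ‖ρ⁻¹ • w x‖ₑ ^ p) ∂volume) ^
          (1 / p) := by
  obtain ⟨C, hC, hCw⟩ := exists_sobolev_unitBall_of_contDiff.{u} hp hpn
  have hps := sobolevConj_pos hp hpn
  have hp0 : 0 < p := by linarith
  set V := volume (Metric.ball (0 : EuclideanSpace ℝ (Fin n)) 1) with hV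
  have hV0 : V ≠ 0 := (Metric.measure_ball_pos _ _ one_pos).ne'
  have hVt : V ≠ ⊤ := measure_ball_lt_top.ne
  refine ⟨(V⁻¹) ^ (1 / sobolevConj n p) * C * V ^ (1 / p), ?_, fun F _ _ w hw y ρ hρ ↦ ?_⟩
  · refine ENNReal.mul_ne_top (ENNReal.mul_ne_top ?_ hC) ?_ <;>
      exact ENNReal.rpow_ne_top_of_nonneg (by positivity) (by simp [hV0, hVt])
  have haff : ContDiff ℝ 1 fun x : EuclideanSpace ℝ (Fin n) ↦ y + ρ • x := by fun_prop
  -- The prefactor `ρ⁻¹` makes the rescaled derivative equal to the original one.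
  have hu : ContDiff ℝ 1 fun x ↦ ρ⁻¹ • w (y + ρ • x) := (hw.comp haff).const_smul _
  have hder : ∀ x, fderiv ℝ (fun x ↦ ρ⁻¹ • w (y + ρ • x)) x = fderiv ℝ w (y + ρ • x) := by
    intro x
    have h1 : HasFDerivAt (fun x : EuclideanSpace ℝ (Fin n) ↦ y + ρ • x)
        (ρ • ContinuousLinearMap.id ℝ _) x := ((hasFDerivAt_id x).const_smul ρ).const_add y
    have h2 := ((hw.differentiable one_ne_zero (y + ρ • x)).hasFDerivAt.comp x h1).const_smul ρ⁻¹
    refine h2.fderiv.trans ?_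
    ext v
    simp [hρ.ne']
  have h := hCw F _ hu
  simp only [hder] at h
  have e1 := laverage_ball_comp_add_smul y hρ fun x ↦ ‖ρ⁻¹ • w x‖ₑ ^ sobolevConj n p
  have e2 := laverage_ball_comp_add_smul y hρ fun x ↦ ‖fderiv ℝ w x‖ₑ ^ p + ‖ρ⁻¹ • w x‖ₑ ^ p
  have hdiv : ∀ (A : ℝ≥0∞) (z : ℝ), 0 ≤ z → (A / V) ^ z = A ^ z * V⁻¹ ^ z := fun A z hz ↦ by
    rw [div_eq_mul_inv, ENNReal.mul_rpow_of_nonneg _ _ hz]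
  rw [← e1, ← e2, setLAverage_eq, setLAverage_eq, ← hV, hdiv _ _ (by positivity),
    hdiv _ _ (by positivity)]
  have hVV : V ^ (1 / p) * V⁻¹ ^ (1 / p) = 1 := by
    rw [← ENNReal.mul_rpow_of_nonneg _ _ (by positivity), ENNReal.mul_inv_cancel hV0 hVt,
      ENNReal.one_rpow]
  set I := ∫⁻ x in Metric.ball (0 : EuclideanSpace ℝ (Fin n)) 1,
    (‖fderiv ℝ w (y + ρ • x)‖ₑ ^ p + ‖ρ⁻¹ • w (y + ρ • x)‖ₑ ^ p)
  calc _ ≤ C * I ^ (1 / p) * V⁻¹ ^ (1 / sobolevConj n p) := by gcongr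
    _ = V⁻¹ ^ (1 / sobolevConj n p) * C * I ^ (1 / p) * (V ^ (1 / p) * V⁻¹ ^ (1 / p)) := by
        rw [hVV]; ring
    _ = _ := by ring

/-! ### Mollification and the Sobolev inequality for weak derivatives. -/

/-- The kernel is a probability density: Jensen's inequality (through Hölder) holds pointwise, then
Tonelli and translation invariance apply. -/
theorem lintegral_enorm_normed_convolution_rpow_le {E : Type*} [NormedAddCommGroup E]
    [NormedSpace ℝ E] [FiniteDimensional ℝ E] [MeasurableSpace E] [BorelSpace E]
    (μ : Measure E) [μ.IsAddHaarMeasure] [HasContDiffBump E] {F : Type*} [NormedAddCommGroup F]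
    [NormedSpace ℝ F] (φ : ContDiffBump (0 : E)) {g : E → F} (hg : AEStronglyMeasurable g μ)
    {p : ℝ} (hp : 1 ≤ p) :
    ∫⁻ x, ‖MeasureTheory.convolution (φ.normed μ) g (ContinuousLinearMap.lsmul ℝ ℝ) μ x‖ₑ ^ p ∂μ ≤
      ∫⁻ x, ‖g x‖ₑ ^ p ∂μ := by
  have hp0 : 0 < p := by linarith
  have hp1 : 0 ≤ (p - 1) / p := by have := sub_nonneg.2 hp; positivity
  let κ : E → ℝ≥0∞ := fun t ↦ ‖φ.normed μ t‖ₑ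
  have hκm : Measurable κ := φ.continuous_normed.enorm.measurable
  have hκ : ∫⁻ t, κ t ∂μ = 1 := by
    simp only [κ, Real.enorm_of_nonneg (φ.nonneg_normed _)]
    rw [← ofReal_integral_eq_lintegral_ofReal φ.integrable_normed
      (Filter.Eventually.of_forall fun t ↦ φ.nonneg_normed t), φ.integral_normed,
      ENNReal.ofReal_one]
  have hgx : ∀ x, AEMeasurable (fun t ↦ ‖g (x - t)‖ₑ ^ p) μ := fun x ↦
    ((hg.comp_quasiMeasurePreserving (quasiMeasurePreserving_sub_left μ x)).enorm).pow_const _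
  have hpt : ∀ x, ‖MeasureTheory.convolution (φ.normed μ) g (ContinuousLinearMap.lsmul ℝ ℝ) μ x‖ₑ ^
      p ≤ ∫⁻ t, κ t * ‖g (x - t)‖ₑ ^ p ∂μ := by
    intro x
    have h := ENNReal.lintegral_mul_norm_pow_le (μ := μ) (f := κ)
      (g := fun t ↦ κ t * ‖g (x - t)‖ₑ ^ p) hκm.aemeasurable (hκm.aemeasurable.mul (hgx x))
      (p := (p - 1) / p) (q := 1 / p) hp1 (by positivity) (by field_simp; ring)
    rw [hκ, ENNReal.one_rpow, one_mul] at h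
    have h2 := ENNReal.rpow_le_rpow h hp0.le
    rw [← ENNReal.rpow_mul _ (1 / p) p, one_div_mul_cancel hp0.ne', ENNReal.rpow_one] at h2
    refine le_trans ?_ h2
    gcongr
    rw [convolution_lsmul]
    refine (enorm_integral_le_lintegral_enorm _).trans (lintegral_mono fun t ↦ le_of_eq ?_)
    rw [enorm_smul, ENNReal.mul_rpow_of_nonneg _ _ (by positivity), ← ENNReal.rpow_mul,
      mul_one_div_cancel hp0.ne', ENNReal.rpow_one, ← mul_assoc,
      ← ENNReal.rpow_add_of_nonneg _ _ hp1 (by positivity),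
      show (p - 1) / p + 1 / p = 1 by field_simp; ring, ENNReal.rpow_one]
  calc _ ≤ ∫⁻ x, ∫⁻ t, κ t * ‖g (x - t)‖ₑ ^ p ∂μ ∂μ := lintegral_mono hpt
    _ = ∫⁻ t, ∫⁻ x, κ t * ‖g (x - t)‖ₑ ^ p ∂μ ∂μ := by
        refine lintegral_lintegral_swap ?_
        refine (hκm.comp measurable_snd).aemeasurable.mul (AEMeasurable.pow_const ?_ _)
        exact (hg.comp_quasiMeasurePreserving
          (quasiMeasurePreserving_sub_of_right_invariant μ μ)).enorm
    _ = ∫⁻ t, κ t * ∫⁻ x, ‖g x‖ₑ ^ p ∂μ ∂μ := by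
        refine lintegral_congr fun t ↦ ?_
        rw [lintegral_const_mul' _ _ enorm_ne_top,
          lintegral_sub_right_eq_self (fun x ↦ ‖g x‖ₑ ^ p) t]
    _ = _ := by rw [lintegral_mul_const _ hκm, hκ, one_mul]

/-- The reflected kernel `t ↦ φ(x - t)` is an admissible test function as long as its support stays
in `Ω`; away from the boundary, extension by zero is therefore harmless. -/
theorem fderiv_normed_convolution_of_hasWeakDerivOn {n : ℕ} {F : Type*} [NormedAddCommGroup F]
    [NormedSpace ℝ F] [CompleteSpace F] {f : EuclideanSpace ℝ (Fin n) → F}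
    {Df : EuclideanSpace ℝ (Fin n) → EuclideanSpace ℝ (Fin n) →L[ℝ] F}
    {Ω : Set (EuclideanSpace ℝ (Fin n))} (h : HasWeakDerivOn f Df Ω) (hΩ : MeasurableSet Ω)
    (hf : LocallyIntegrable (Ω.indicator f)) (hDf : LocallyIntegrable (Ω.indicator Df))
    (φ : ContDiffBump (0 : EuclideanSpace ℝ (Fin n))) {x : EuclideanSpace ℝ (Fin n)}
    (hx : Metric.closedBall x φ.rOut ⊆ Ω) :
    fderiv ℝ (MeasureTheory.convolution (φ.normed volume) (Ω.indicator f)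
      (ContinuousLinearMap.lsmul ℝ ℝ) volume) x =
    MeasureTheory.convolution (φ.normed volume) (Ω.indicator Df)
      (ContinuousLinearMap.lsmul ℝ ℝ) volume x := by
  have hφ : ContDiff ℝ ∞ (φ.normed volume) := φ.contDiff_normed
  have hφ1 : ContDiff ℝ 1 (φ.normed volume) := φ.contDiff_normed
  have hφc : HasCompactSupport (φ.normed volume) := φ.hasCompactSupport_normed
  rw [(hφc.hasFDerivAt_convolution_left (ContinuousLinearMap.lsmul ℝ ℝ) hφ1 hf x).fderiv]
  let ψ : EuclideanSpace ℝ (Fin n) → ℝ := fun t ↦ φ.normed volume (x - t)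
  have hψ : ContDiff ℝ ∞ ψ := hφ.comp (contDiff_const.sub contDiff_id)
  have hψs : tsupport ψ ⊆ Metric.closedBall x φ.rOut := by
    refine closure_minimal (fun t ht ↦ ?_) Metric.isClosed_closedBall
    have : x - t ∈ Function.support (φ.normed volume) := ht
    rw [φ.support_normed_eq, mem_ball_zero_iff] at this
    rw [mem_closedBall_iff_norm']
    exact this.le
  have hψc : HasCompactSupport ψ :=
    (isCompact_closedBall x φ.rOut).of_isClosed_subset (isClosed_tsupport ψ) hψs
  have hψd : ∀ t v, fderiv ℝ ψ t v = -fderiv ℝ (φ.normed volume) (x - t) v := by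
    intro t v
    have h1 : HasFDerivAt (fun t : EuclideanSpace ℝ (Fin n) ↦ x - t)
        (-ContinuousLinearMap.id ℝ _) t := (hasFDerivAt_id t).const_sub x
    have h2 := (hφ1.differentiable one_ne_zero (x - t)).hasFDerivAt.comp t h1
    rw [show fderiv ℝ ψ t = _ from h2.fderiv]
    simp
  ext v
  have hw := h.2.2 ψ hψ hψc (hψs.trans hx) v
  rw [convolution_eq_swap, convolution_eq_swap,
    ContinuousLinearMap.integral_apply, ContinuousLinearMap.integral_apply]
  · calc _ = ∫ t in Ω, -((fderiv ℝ ψ t v) • f t) := by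
          rw [← integral_indicator hΩ]
          congr 1 with t
          by_cases ht : t ∈ Ω
          · simp [ht, hψd, ContinuousLinearMap.precompL_apply]
          · simp [ht]
      _ = ∫ t in Ω, ψ t • Df t v := by rw [integral_neg, hw, neg_neg]
      _ = _ := by
          rw [← integral_indicator hΩ]
          congr 1 with t
          by_cases ht : t ∈ Ω
          · simp [ht, ψ]
          · simp [ht]
  · have hex : ConvolutionExistsAt (φ.normed volume) (Ω.indicator Df) x
        (ContinuousLinearMap.lsmul ℝ ℝ) volume :=
      hφc.convolutionExists_left _ hφ.continuous hDf x
    exact hex.integrable_swap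
  · have hex : ConvolutionExistsAt (fderiv ℝ (φ.normed volume)) (Ω.indicator f) x
        ((ContinuousLinearMap.lsmul ℝ ℝ).precompL (EuclideanSpace ℝ (Fin n))) volume :=
      (hφc.fderiv ℝ).convolutionExists_left _ (hφ1.continuous_fderiv one_ne_zero) hf x
    exact hex.integrable_swap

theorem integrableOn_of_setLIntegral_rpow_ne_top {α : Type*} [MeasurableSpace α] {μ : Measure α}
    {F : Type*} [NormedAddCommGroup F] {g : α → F} {s : Set α} (hs : μ s ≠ ⊤)
    (hg : AEStronglyMeasurable g (μ.restrict s)) {p : ℝ} (hp : 1 ≤ p)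
    (h : ∫⁻ x in s, ‖g x‖ₑ ^ p ∂μ ≠ ⊤) : IntegrableOn g s μ := by
  have : IsFiniteMeasure (μ.restrict s) := ⟨by simpa using hs.lt_top⟩
  have hp0 : 0 < p := by linarith
  have hmem : MemLp g (ENNReal.ofReal p) (μ.restrict s) := by
    refine ⟨hg, ?_⟩
    rw [eLpNorm_lt_top_iff_lintegral_rpow_enorm_lt_top (by simpa using hp0) ENNReal.ofReal_ne_top,
      ENNReal.toReal_ofReal hp0.le]
    exact h.lt_top
  exact hmem.integrable (by simpa using hp)

theorem exists_sobolev_ball_of_hasWeakDerivOn {n : ℕ} {p : ℝ} (hp : 1 ≤ p) (hpn : p < n) :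
    ∃ C : ℝ≥0∞, C ≠ ⊤ ∧ 1 ≤ C ∧ ∀ (F : Type u) [NormedAddCommGroup F] [InnerProductSpace ℝ F]
      [CompleteSpace F] (y : EuclideanSpace ℝ (Fin n)) (r : ℝ), 0 < r →
      ∀ (f : EuclideanSpace ℝ (Fin n) → F)
        (Df : EuclideanSpace ℝ (Fin n) → EuclideanSpace ℝ (Fin n) →L[ℝ] F),
        HasWeakDerivOn f Df (Metric.ball y r) →
        (⨍⁻ x in Metric.ball y r, ‖r⁻¹ • f x‖ₑ ^ sobolevConj n p ∂volume) ^
            (1 / sobolevConj n p) ≤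
          C * (⨍⁻ x in Metric.ball y r, (‖Df x‖ₑ ^ p + ‖r⁻¹ • f x‖ₑ ^ p) ∂volume) ^ (1 / p) := by
  obtain ⟨C, hC, hCw⟩ := exists_sobolev_ball_of_contDiff.{u} hp hpn
  have hps := sobolevConj_pos hp hpn
  have hp0 : 0 < p := by linarith
  have hn0 : (0 : ℝ) < n := by linarith
  have : Nonempty (Fin n) := ⟨⟨0, by exact_mod_cast hn0⟩⟩
  set P := sobolevConj n p with hP
  -- The cost of passing from radius `r` to `ρ ≥ r / 2`: `2 ^ n` for the volumes, `2 ^ p` for `ρ⁻¹ ≤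
  -- 2 r⁻¹`.
  let M : ℝ≥0∞ := 2 ^ n * 2 ^ p
  have hMt : M ≠ ⊤ := ENNReal.mul_ne_top (by simp) (ENNReal.rpow_ne_top_of_nonneg hp0.le (by simp))
  refine ⟨1 + C * M ^ (1 / p), ?_, le_self_add, fun F _ _ _ y r hr f Df h ↦ ?_⟩
  · exact ENNReal.add_ne_top.2 ⟨by simp, ENNReal.mul_ne_top hC
      (ENNReal.rpow_ne_top_of_nonneg (by positivity) hMt)⟩
  set D := ⨍⁻ x in Metric.ball y r, (‖Df x‖ₑ ^ p + ‖r⁻¹ • f x‖ₑ ^ p) ∂volume with hD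
  rcases eq_or_ne D ⊤ with hDt | hDt
  · rw [hDt, ENNReal.top_rpow_of_pos (by positivity), ENNReal.mul_top (by simp)]
    exact le_top
  set B := Metric.ball y r with hB
  have hBm : MeasurableSet B := measurableSet_ball
  have hV0 : volume B ≠ 0 := (Metric.measure_ball_pos _ _ hr).ne'
  have hVt : volume B ≠ ⊤ := measure_ball_lt_top.ne
  have hfm : AEStronglyMeasurable f (volume.restrict B) := h.1.aestronglyMeasurable
  have hDfm : AEStronglyMeasurable Df (volume.restrict B) := h.2.1.aestronglyMeasurable
  have hsm : ∀ z : F, ‖r⁻¹ • z‖ₑ ^ p = ‖r⁻¹‖ₑ ^ p * ‖z‖ₑ ^ p := fun z ↦ by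
    rw [enorm_smul, ENNReal.mul_rpow_of_nonneg _ _ hp0.le]
  set I₁ := ∫⁻ x in B, ‖Df x‖ₑ ^ p with hI₁
  set I₀ := ∫⁻ x in B, ‖f x‖ₑ ^ p with hI₀
  have hcr0 : ‖r⁻¹‖ₑ ^ p ≠ 0 := by
    rw [Ne, ENNReal.rpow_eq_zero_iff]
    simp [hr.ne', hp0.not_gt]
  have hcrt : ‖r⁻¹‖ₑ ^ p ≠ ⊤ := ENNReal.rpow_ne_top_of_nonneg hp0.le enorm_ne_top
  have hDI : (I₁ + ‖r⁻¹‖ₑ ^ p * I₀) / volume B = D := by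
    rw [hD, setLAverage_eq, lintegral_add_left' (hDfm.enorm.pow_const _)]
    simp only [hsm]
    rw [lintegral_const_mul' _ _ hcrt]
  have hsum : I₁ + ‖r⁻¹‖ₑ ^ p * I₀ ≠ ⊤ := by
    intro ht
    rw [ht, ENNReal.top_div_of_ne_top hVt] at hDI
    exact hDt hDI.symm
  have hI₁t : I₁ ≠ ⊤ := (ENNReal.add_ne_top.1 hsum).1
  have hI₀t : I₀ ≠ ⊤ := fun ht ↦ (ENNReal.add_ne_top.1 hsum).2 (by rw [ht, ENNReal.mul_top hcr0])
  -- Finiteness of `D` upgrades local integrability to integrability up to the boundary, so the zero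
  -- extensions can be mollified.
  have hfi : Integrable (B.indicator f) := (integrable_indicator_iff hBm).2
    (integrableOn_of_setLIntegral_rpow_ne_top hVt hfm hp hI₀t)
  have hDfi : Integrable (B.indicator Df) := (integrable_indicator_iff hBm).2
    (integrableOn_of_setLIntegral_rpow_ne_top hVt hDfm hp hI₁t)
  have hind : ∀ {H : Type u} [NormedAddCommGroup H] (g : EuclideanSpace ℝ (Fin n) → H),
      ∫⁻ x, ‖B.indicator g x‖ₑ ^ p = ∫⁻ x in B, ‖g x‖ₑ ^ p := by
    intro H _ g
    rw [← lintegral_indicator hBm]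
    refine lintegral_congr fun x ↦ ?_
    by_cases hx : x ∈ B
    · simp only [Set.indicator_of_mem hx]
    · simp only [Set.indicator_of_notMem hx, enorm_zero, ENNReal.zero_rpow_of_pos hp0]
  -- Outer radii at most `r / 2` keep `ρ ≥ r / 2`; the fixed ratio 2 of outer to inner radius is
  -- what almost everywhere convergence requires.
  let φ : ℕ → ContDiffBump (0 : EuclideanSpace ℝ (Fin n)) := fun k ↦
    ⟨r / (k + 2) / 2, r / (k + 2), by positivity, half_lt_self (by positivity)⟩
  have hφr : ∀ k, (φ k).rOut = r / (k + 2) := fun _ ↦ rfl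
  have hφlim : Filter.Tendsto (fun k ↦ (φ k).rOut) Filter.atTop (nhds 0) := by
    simp only [hφr]
    exact tendsto_const_nhds.div_atTop
      (Filter.tendsto_atTop_add_const_right _ _ tendsto_natCast_atTop_atTop)
  let w : ℕ → EuclideanSpace ℝ (Fin n) → F := fun k ↦ MeasureTheory.convolution
    ((φ k).normed volume) (B.indicator f) (ContinuousLinearMap.lsmul ℝ ℝ) volume
  have hw1 : ∀ k, ContDiff ℝ 1 (w k) := fun k ↦
    (φ k).hasCompactSupport_normed.contDiff_convolution_left _ (φ k).contDiff_normed
      hfi.locallyIntegrable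
  have hlim : ∀ᵐ x, Filter.Tendsto (fun k ↦ w k x) Filter.atTop (nhds (B.indicator f x)) :=
    ContDiffBump.ae_convolution_tendsto_right_of_locallyIntegrable hφlim (K := 2)
      (Filter.Eventually.of_forall fun k ↦ le_of_eq (by simp only [φ]; ring))
      hfi.locallyIntegrable
  let K : ℝ≥0∞ := volume B * (C * (M * D) ^ (1 / p)) ^ P
  have hbound : ∀ k, ∫⁻ x in Metric.ball y (r - (φ k).rOut), ‖r⁻¹ • w k x‖ₑ ^ P ≤ K := by
    intro k
    set ρ := r - (φ k).rOut with hρ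
    have hkr : (φ k).rOut ≤ r / 2 := by
      rw [hφr]
      gcongr
      have : (0 : ℝ) ≤ k := k.cast_nonneg
      linarith
    have hkr0 : 0 < (φ k).rOut := (φ k).rOut_pos
    have hρ0 : 0 < ρ := by linarith
    have hρr : ρ ≤ r := by linarith
    have hVρ0 : volume (Metric.ball y ρ) ≠ 0 := (Metric.measure_ball_pos _ _ hρ0).ne'
    have hVρt : volume (Metric.ball y ρ) ≠ ⊤ := measure_ball_lt_top.ne
    have hVle : volume (Metric.ball y ρ) ≤ volume B := measure_mono (Metric.ball_subset_ball hρr)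
    have hVge : volume B ≤ 2 ^ n * volume (Metric.ball y ρ) := by
      calc volume B ≤ volume (Metric.ball y (2 * ρ)) :=
            measure_mono (Metric.ball_subset_ball (by linarith))
        _ = _ := by
          rw [Measure.addHaar_ball_mul _ _ zero_le_two, Measure.addHaar_ball_center _ y,
            finrank_euclideanSpace_fin, ENNReal.ofReal_pow zero_le_two]
          simp
    have hinv1 : ‖r⁻¹‖ₑ ≤ ‖ρ⁻¹‖ₑ := by
      rw [Real.enorm_of_nonneg (by positivity), Real.enorm_of_nonneg (by positivity)]
      exact ENNReal.ofReal_le_ofReal (by gcongr)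
    have hinv2 : ‖ρ⁻¹‖ₑ ≤ 2 * ‖r⁻¹‖ₑ := by
      rw [Real.enorm_of_nonneg (by positivity), Real.enorm_of_nonneg (by positivity),
        show (2 : ℝ≥0∞) = ENNReal.ofReal 2 by simp, ← ENNReal.ofReal_mul zero_le_two]
      refine ENNReal.ofReal_le_ofReal ?_
      rw [← div_eq_mul_inv, inv_eq_one_div, div_le_div_iff₀ hρ0 hr]
      linarith
    have hder : ∫⁻ x in Metric.ball y ρ, ‖fderiv ℝ (w k) x‖ₑ ^ p ≤ I₁ := by
      calc _ = ∫⁻ x in Metric.ball y ρ, ‖MeasureTheory.convolution ((φ k).normed volume)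
              (B.indicator Df) (ContinuousLinearMap.lsmul ℝ ℝ) volume x‖ₑ ^ p := by
            refine setLIntegral_congr_fun measurableSet_ball fun x hx ↦ ?_
            simp only [w]
            rw [fderiv_normed_convolution_of_hasWeakDerivOn h hBm hfi.locallyIntegrable
              hDfi.locallyIntegrable]
            refine Metric.closedBall_subset_ball' ?_
            have := Metric.mem_ball.1 hx
            linarith
        _ ≤ _ := setLIntegral_le_lintegral _ _
        _ ≤ _ := lintegral_enorm_normed_convolution_rpow_le volume (φ k)
            hDfi.aestronglyMeasurable hp
        _ = I₁ := hind Df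
    have hval : ∫⁻ x in Metric.ball y ρ, ‖ρ⁻¹ • w k x‖ₑ ^ p ≤ 2 ^ p * (‖r⁻¹‖ₑ ^ p * I₀) := by
      calc _ ≤ ∫⁻ x, (2 * ‖r⁻¹‖ₑ) ^ p * ‖w k x‖ₑ ^ p := by
            refine (setLIntegral_le_lintegral _ _).trans (lintegral_mono fun x ↦ ?_)
            rw [enorm_smul, ENNReal.mul_rpow_of_nonneg _ _ hp0.le]
            gcongr
        _ = (2 * ‖r⁻¹‖ₑ) ^ p * ∫⁻ x, ‖w k x‖ₑ ^ p := lintegral_const_mul' _ _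
            (ENNReal.rpow_ne_top_of_nonneg hp0.le (ENNReal.mul_ne_top (by simp) enorm_ne_top))
        _ ≤ (2 * ‖r⁻¹‖ₑ) ^ p * I₀ := by
            gcongr
            exact (lintegral_enorm_normed_convolution_rpow_le volume (φ k)
              hfi.aestronglyMeasurable hp).trans_eq (hind f)
        _ = _ := by rw [ENNReal.mul_rpow_of_nonneg _ _ hp0.le, mul_assoc]
    have havg : ⨍⁻ x in Metric.ball y ρ, (‖fderiv ℝ (w k) x‖ₑ ^ p + ‖ρ⁻¹ • w k x‖ₑ ^ p) ∂volume ≤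
        M * D := by
      rw [setLAverage_eq, lintegral_add_left
        (((hw1 k).continuous_fderiv one_ne_zero).enorm.measurable.pow_const _)]
      have h2p : (1 : ℝ≥0∞) ≤ 2 ^ p := ENNReal.one_le_rpow (by norm_num) hp0
      calc _ ≤ (2 ^ p * (I₁ + ‖r⁻¹‖ₑ ^ p * I₀)) / volume (Metric.ball y ρ) := by
            rw [mul_add]
            gcongr
            exact hder.trans (le_mul_of_one_le_left' h2p)
        _ ≤ (2 ^ p * (I₁ + ‖r⁻¹‖ₑ ^ p * I₀)) * (2 ^ n / volume B) := by
            rw [div_eq_mul_inv]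
            gcongr
            rw [ENNReal.le_div_iff_mul_le (Or.inl hV0) (Or.inl hVt), mul_comm,
              ← div_eq_mul_inv]
            exact ENNReal.div_le_of_le_mul hVge
        _ = M * D := by
            rw [← hDI]
            simp only [M, div_eq_mul_inv]
            ring
    have hS := hCw F (w k) (hw1 k) y ρ hρ0
    have hS2 : ⨍⁻ x in Metric.ball y ρ, ‖ρ⁻¹ • w k x‖ₑ ^ P ∂volume ≤
        (C * (M * D) ^ (1 / p)) ^ P := by
      rw [← ENNReal.rpow_le_rpow_iff (z := 1 / P) (by positivity), ← ENNReal.rpow_mul,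
        mul_one_div_cancel hps.ne', ENNReal.rpow_one]
      refine hS.trans ?_
      gcongr
    calc _ ≤ ∫⁻ x in Metric.ball y ρ, ‖ρ⁻¹ • w k x‖ₑ ^ P := by
          refine lintegral_mono fun x ↦ ?_
          simp only [enorm_smul]
          gcongr
      _ = volume (Metric.ball y ρ) * ⨍⁻ x in Metric.ball y ρ, ‖ρ⁻¹ • w k x‖ₑ ^ P ∂volume := by
          rw [setLAverage_eq, ENNReal.mul_div_cancel hVρ0 hVρt]
      _ ≤ K := mul_le_mul' hVle hS2
  -- The smaller balls exhaust `B`, and `K` does not depend on `k`.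
  have hfatou : ∫⁻ x in B, ‖r⁻¹ • f x‖ₑ ^ P ≤ K := by
    let g : ℕ → EuclideanSpace ℝ (Fin n) → ℝ≥0∞ := fun k ↦
      (Metric.ball y (r - (φ k).rOut)).indicator fun x ↦ ‖r⁻¹ • w k x‖ₑ ^ P
    have hgm : ∀ k, Measurable (g k) := fun k ↦
      (((hw1 k).continuous.const_smul r⁻¹).enorm.measurable.pow_const _).indicator
        measurableSet_ball
    calc _ = ∫⁻ x in B, Filter.liminf (fun k ↦ g k x) Filter.atTop := by
          refine lintegral_congr_ae ?_
          filter_upwards [ae_restrict_of_ae hlim, ae_restrict_mem hBm] with x hx hxB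
          rw [Set.indicator_of_mem hxB] at hx
          have hev : ∀ᶠ k in Filter.atTop, ‖r⁻¹ • w k x‖ₑ ^ P = g k x := by
            have : Filter.Tendsto (fun k ↦ r - (φ k).rOut) Filter.atTop (nhds (r - 0)) :=
              hφlim.const_sub r
            rw [sub_zero] at this
            filter_upwards [this.eventually_const_lt (Metric.mem_ball.1 hxB)] with k hk
            simp only [g]
            rw [Set.indicator_of_mem (Metric.mem_ball.2 hk)]
          refine (Filter.Tendsto.liminf_eq (Filter.Tendsto.congr' hev ?_)).symm
          exact ((ENNReal.continuous_rpow_const.tendsto _).comp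
            ((continuous_enorm.tendsto _).comp (hx.const_smul r⁻¹)))
      _ ≤ Filter.liminf (fun k ↦ ∫⁻ x in B, g k x) Filter.atTop := lintegral_liminf_le hgm
      _ ≤ K := by
          refine Filter.liminf_le_of_frequently_le' (Filter.Frequently.of_forall fun k ↦ ?_)
          refine (setLIntegral_le_lintegral _ _).trans ?_
          rw [lintegral_indicator measurableSet_ball]
          exact hbound k
  have hfin : ⨍⁻ x in B, ‖r⁻¹ • f x‖ₑ ^ P ∂volume ≤ (C * (M * D) ^ (1 / p)) ^ P := by
    rw [setLAverage_eq]
    exact ENNReal.div_le_of_le_mul' hfatou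
  calc _ ≤ ((C * (M * D) ^ (1 / p)) ^ P) ^ (1 / P) := by gcongr
    _ = C * M ^ (1 / p) * D ^ (1 / p) := by
        rw [← ENNReal.rpow_mul, mul_one_div_cancel hps.ne', ENNReal.rpow_one,
          ENNReal.mul_rpow_of_nonneg _ _ (by positivity), mul_assoc]
    _ ≤ _ := by
        gcongr
        exact le_add_self

/-! ### Interpolation of exponents and conclusion. -/

theorem lintegral_rpow_rpow_one_div_le_interpolation {α : Type*} [MeasurableSpace α]
    {ν : Measure α} [IsProbabilityMeasure ν] {g : α → ℝ≥0∞} (hg : AEMeasurable g ν)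
    {γ P q θ : ℝ} (hγ : 0 < γ) (hP : 0 < P) (hq : 0 < q) (hθ : 0 ≤ θ) (hθ1 : θ ≤ 1)
    (h : θ / P + (1 - θ) / q ≤ 1 / γ) :
    (∫⁻ x, g x ^ γ ∂ν) ^ (1 / γ) ≤
      (∫⁻ x, g x ^ P ∂ν) ^ (θ / P) * (∫⁻ x, g x ^ q ∂ν) ^ ((1 - θ) / q) := by
  -- The exponent `1 / m` is the exact interpolant of `P` and `q`: Hölder is sharp there, and Jensen
  -- descends to `γ ≤ 1 / m`.
  have hθ' : 0 ≤ 1 - θ := sub_nonneg.2 hθ1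
  set m := θ / P + (1 - θ) / q with hm
  have hm0 : 0 < m := by
    rcases hθ.eq_or_lt with h0 | h0
    · rw [hm, ← h0]; simp [hq]
    · have : 0 ≤ (1 - θ) / q := by positivity
      have : 0 < θ / P := by positivity
      linarith
  have hγm : γ * m ≤ 1 := by
    rwa [le_div_iff₀ hγ, mul_comm] at h
  have hjensen : ∫⁻ x, g x ^ γ ∂ν ≤ (∫⁻ x, g x ^ (1 / m) ∂ν) ^ (γ * m) := by
    have := ENNReal.lintegral_mul_norm_pow_le (μ := ν) (hg.pow_const (1 / m))
      (aemeasurable_const (b := (1 : ℝ≥0∞))) (p := γ * m) (q := 1 - γ * m) (by positivity)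
      (sub_nonneg.2 hγm) (by ring)
    simpa only [← ENNReal.rpow_mul, show 1 / m * (γ * m) = γ by field_simp, ENNReal.one_rpow,
      mul_one, lintegral_const, measure_univ] using this
  have hholder : ∫⁻ x, g x ^ (1 / m) ∂ν ≤
      (∫⁻ x, g x ^ P ∂ν) ^ (θ / P / m) * (∫⁻ x, g x ^ q ∂ν) ^ ((1 - θ) / q / m) := by
    have := ENNReal.lintegral_mul_norm_pow_le (μ := ν) (hg.pow_const P) (hg.pow_const q)
      (p := θ / P / m) (q := (1 - θ) / q / m) (by positivity) (by positivity)
      (by rw [← add_div, ← hm, div_self hm0.ne'])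
    refine le_trans (le_of_eq (lintegral_congr fun x ↦ ?_)) this
    rw [← ENNReal.rpow_mul, ← ENNReal.rpow_mul,
      ← ENNReal.rpow_add_of_nonneg _ _ (by positivity) (by positivity)]
    congr 1
    have h1 : P * (θ / P / m) = θ / m := by field_simp
    have h2 : q * ((1 - θ) / q / m) = (1 - θ) / m := by field_simp
    rw [h1, h2, ← add_div]
    congr 1
    ring
  calc (∫⁻ x, g x ^ γ ∂ν) ^ (1 / γ)
      ≤ ((∫⁻ x, g x ^ (1 / m) ∂ν) ^ (γ * m)) ^ (1 / γ) := by gcongr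
    _ = (∫⁻ x, g x ^ (1 / m) ∂ν) ^ m := by
        rw [← ENNReal.rpow_mul]; congr 1; field_simp
    _ ≤ ((∫⁻ x, g x ^ P ∂ν) ^ (θ / P / m) * (∫⁻ x, g x ^ q ∂ν) ^ ((1 - θ) / q / m)) ^ m := by
        gcongr
    _ = _ := by
        rw [ENNReal.mul_rpow_of_nonneg _ _ hm0.le, ← ENNReal.rpow_mul, ← ENNReal.rpow_mul,
          div_mul_cancel₀ _ hm0.ne', div_mul_cancel₀ _ hm0.ne']

/-- Scaling-invariant Gagliardo–Nirenberg inequality on balls. All mean values are taken in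
`[0, ∞]`, so nothing is assumed to be finite; the norm of `Df x` is the operator norm, which is the
Euclidean norm of the gradient if `f` is real-valued. -/
theorem lemma2p5 (n : ℕ) (p : ℝ) (hp : 1 ≤ p) (hpn : p < n) :
    ∃ c : ℝ, 0 < c ∧
      ∀ (F : Type*) [NormedAddCommGroup F] [InnerProductSpace ℝ F] [FiniteDimensional ℝ F]
        (γ q θ : ℝ), 0 < γ → 0 < q → 0 ≤ θ → θ ≤ 1 →
        1 / γ ≥ θ / sobolevConj n p + (1 - θ) / q →
        ∀ (y : EuclideanSpace ℝ (Fin n)) (r : ℝ), 0 < r →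
        ∀ (f : EuclideanSpace ℝ (Fin n) → F)
          (Df : EuclideanSpace ℝ (Fin n) → EuclideanSpace ℝ (Fin n) →L[ℝ] F),
          HasWeakDerivOn f Df (Metric.ball y r) →
          (⨍⁻ x in Metric.ball y r, ‖r⁻¹ • f x‖ₑ ^ γ ∂volume) ^ (1 / γ) ≤
            ENNReal.ofReal c *
              (⨍⁻ x in Metric.ball y r, (‖Df x‖ₑ ^ p + ‖r⁻¹ • f x‖ₑ ^ p) ∂volume) ^ (θ / p) *
              (⨍⁻ x in Metric.ball y r, ‖r⁻¹ • f x‖ₑ ^ q ∂volume) ^ ((1 - θ) / q) := by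
  obtain ⟨C, hC, hC1, hCw⟩ := exists_sobolev_ball_of_hasWeakDerivOn hp hpn
  have hps := sobolevConj_pos hp hpn
  have hp0 : 0 < p := by linarith
  refine ⟨C.toReal, ENNReal.toReal_pos (zero_lt_one.trans_le hC1).ne' hC, ?_⟩
  intro F _ _ _ γ q θ hγ hq hθ hθ1 hγq y r hr f Df h
  have : CompleteSpace F := FiniteDimensional.complete ℝ F
  have hS := hCw F y r hr f Df h
  rw [ENNReal.ofReal_toReal hC]
  set B := Metric.ball y r
  have hV0 : volume B ≠ 0 := (Metric.measure_ball_pos _ _ hr).ne'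
  have hVt : volume B ≠ ⊤ := measure_ball_lt_top.ne
  have hprob : IsProbabilityMeasure ((volume B)⁻¹ • volume.restrict B) := ⟨by
    rw [Measure.smul_apply, Measure.restrict_apply_univ, smul_eq_mul,
      ENNReal.inv_mul_cancel hV0 hVt]⟩
  have hg : AEMeasurable (fun x ↦ ‖r⁻¹ • f x‖ₑ) ((volume B)⁻¹ • volume.restrict B) :=
    (h.1.aestronglyMeasurable.const_smul r⁻¹).enorm.smul_measure _
  have hint := lintegral_rpow_rpow_one_div_le_interpolation hg hγ hps hq hθ hθ1 hγq
  simp only [← setLAverage_eq'] at hint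
  refine hint.trans ?_
  gcongr
  have hS' := ENNReal.rpow_le_rpow hS hθ
  rw [← ENNReal.rpow_mul, one_div_mul_eq_div, ENNReal.mul_rpow_of_nonneg _ _ hθ,
    ← ENNReal.rpow_mul, one_div_mul_eq_div] at hS'
  refine hS'.trans ?_
  gcongr
  -- Since `C ≥ 1`, `C ^ θ ≤ C`, which makes the constant independent of `θ`.
  exact (ENNReal.rpow_le_rpow_of_exponent_le hC1 hθ1).trans_eq (ENNReal.rpow_one C)
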